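/- Let $V$ be a vertex operator algebra over $\mathbb C$: a vertex algebra with vacuum $\mathbf 1$, translation operator $D$ and mutually local fields $Y_V(a,z)=\sum_{n\in\mathbb Z}a_{(n)}z^{-n-1}$, together with a Virasoro element $\omega$, $Y_V(\omega,z)=\sum_n L(n)z^{-n-2}$, such that the $L(n)$ satisfy the Virasoro relations with some central charge, $D=L(-1)$, and $V$ is the direct sum over $n\in\mathbb Z$ of subspaces on which $L(0)$ acts as $n\,\mathrm{Id}$. Let $M$ be a $V$-module, that is, a complex vector space with fields $Y_M(a,z)=\sum_{n\in\mathbb Z}a_{(n)}z^{-n-1}$ on $M$ (for each $x\in M$, $a_{(n)}x=0$ for $n$ sufficiently large), linear in $a\in V$, such that $Y_M(\mathbf 1,z)=\mathrm{Id}_M$ and the Borcherds identity holds on $M$ (no grading of $M$ is required). Call $M$ faithful if $Y_M(a,z)=0$ implies $a=0$. Put $\delta(x)=\sum_{i\in\mathbb Z}x^i$. Let $S,K\subset\mathbb Z$ and $N\subset\mathbb Z_{\ge 0}$ be finite sets, for each $n\in N$ let $J_n\subset\mathbb Z$ be a finite set, and let $a^s,b^k,c^{nj}\in V$ for $s\in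 S$, $k\in K$, $n\in N$, $j\in J_n$. For $Y=Y_V$ or $Y=Y_M$ consider the identity $$\Big[\sum_{s\in S} z^{-s}Y(a^s,z),\ \sum_{k\in K} w^{-k}Y(b^k,w)\Big]=\sum_{n\in N}\sum_{j\in J_n} w^{-j}\,Y(c^{nj},w)\Big[z^{-1}\Big(\frac{\partial}{\partial w}\Big)^{n}\delta\Big(\frac wz\Big)\Big].\qquad(\ast)_Y$$ (i) If $M$ is faithful and $\sum_{s\in S} z^{-s}Y_M(a^s,z)=0$, then $a^s=0$ for all $s\in S$. (ii) If $(\ast)_{Y_V}$ holds, then $(\ast)_{Y_M}$ holds. (iii) If $M$ is faithful and $(\ast)_{Y_M}$ holds, then $(\ast)_{Y_V}$ holds. -/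

import Mathlib

/-! Formal distributions. A formal distribution in one variable `z` with coefficients in `E` is a
function `f : ℤ → E`, where `f p` is the coefficient of `z ^ p`. A formal distribution in two
variables `z, w` is a function `F : ℤ → ℤ → E`, where `F p q` is the coefficient of
`z ^ p * w ^ q`. -/

namespace FormalDist

variable {E : Type*}

/-- The product `z ^ s * f(z)`. -/
def shift (s : ℤ) (f : ℤ → E) : ℤ → E := fun p => f (p - s)

/-- The formal derivative `d/dz f(z)`. -/
def deriv [AddCommGroup E] (f : ℤ → E) : ℤ → E := fun p => (p + 1) • f (p + 1)

/-- The formal partial derivative `∂/∂w F(z, w)`. -/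
def derivW [AddCommGroup E] (F : ℤ → ℤ → E) : ℤ → ℤ → E := fun p => deriv (F p)

/-- The product `(z - w) * F(z, w)`. -/
def mulSub [AddCommGroup E] (F : ℤ → ℤ → E) : ℤ → ℤ → E :=
  fun p q => F (p - 1) q - F p (q - 1)

/-- The commutator `[f(z), g(w)] = f(z) g(w) - g(w) f(z)`. -/
def bracket [Ring E] (f g : ℤ → E) : ℤ → ℤ → E := fun p q => f p * g q - g q * f p

/-- The scalar distribution `z⁻¹ δ(w / z)`, where `δ(x) = ∑_{i ∈ ℤ} x ^ i`; that is, the sum of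
`z ^ (-i - 1) * w ^ i` over all integers `i`. -/
def zInvDelta : ℤ → ℤ → ℂ := fun p q => if p = -q - 1 then 1 else 0

/-- The product `g(w) * F(z, w)` with a scalar distribution `F`. It is meaningful if every
power of `z` occurs in `F` together with only finitely many powers of `w`, as is the case for the
derivatives of `z⁻¹ δ(w / z)`. -/
noncomputable def mulW [AddCommGroup E] [Module ℂ E] (g : ℤ → E) (F : ℤ → ℤ → ℂ) : ℤ → ℤ → E :=
  fun p q => ∑ᶠ i : ℤ, F p i • g (q - i)

end FormalDist

/-- A vertex algebra structure on the complex vector space `V`. The state-field correspondence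
sends `a` to the field `Y(a, z) = ∑ a_(n) z ^ (-n - 1)`, where `a_(n)` is
`VertexOperator.ncoeff (Y a) n`. That `a_(n) b = 0` for `n` large is part of the notion
`VertexOperator`, which takes a vector to a Laurent series. -/
structure VertexAlgebra (V : Type*) [AddCommGroup V] [Module ℂ V] where
  /-- the vacuum vector -/
  vac : V
  /-- the infinitesimal translation -/
  D : Module.End ℂ V
  /-- the state-field correspondence -/
  Y : V →ₗ[ℂ] VertexOperator ℂ V
  /-- `[D, Y(a, z)] = Y(D a, z)` -/
  translation_bracket : ∀ (a : V) (p : ℤ),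
    D * HVertexOperator.coeff (Y a) p - HVertexOperator.coeff (Y a) p * D
      = HVertexOperator.coeff (Y (D a)) p
  /-- `Y(D a, z) = d/dz Y(a, z)` -/
  translation_deriv : ∀ a : V,
    HVertexOperator.coeff (Y (D a)) = FormalDist.deriv (HVertexOperator.coeff (Y a))
  /-- `Y(1, z) = Id` -/
  vacuum : ∀ n : ℤ, VertexOperator.ncoeff (Y vac) n = if n = -1 then 1 else 0
  /-- `Y(a, z) 1` has no negative powers of `z` -/
  creation_regular : ∀ (a : V) (n : ℤ), 0 ≤ n → VertexOperator.ncoeff (Y a) n vac = 0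
  /-- `Y(a, z) 1` at `z = 0` equals `a` -/
  creation_value : ∀ a : V, VertexOperator.ncoeff (Y a) (-1) vac = a
  /-- `(z - w) ^ N [Y(a, z), Y(b, w)] = 0` for `N` large -/
  locality : ∀ a b : V, ∃ N : ℕ,
    FormalDist.mulSub^[N]
      (FormalDist.bracket (HVertexOperator.coeff (Y a)) (HVertexOperator.coeff (Y b))) = 0

/-- A vertex operator algebra structure on `V`: a vertex algebra with a Virasoro element `ω`.
Here `L(n) = ω_(n+1)`. -/
structure VertexOperatorAlgebra (V : Type*) [AddCommGroup V] [Module ℂ V]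
    extends VertexAlgebra V where
  /-- the Virasoro element -/
  ω : V
  /-- the rank (central charge) -/
  rank : ℂ
  /-- `[L(n), L(m)] = (n - m) L(n + m) + δ_{n,-m} (n³ - n) / 12 rank Id` -/
  virasoro : ∀ n m : ℤ,
    VertexOperator.ncoeff (Y ω) (n + 1) * VertexOperator.ncoeff (Y ω) (m + 1)
        - VertexOperator.ncoeff (Y ω) (m + 1) * VertexOperator.ncoeff (Y ω) (n + 1)
      = (n - m) • VertexOperator.ncoeff (Y ω) (n + m + 1)
        + (if n = -m then ((n : ℂ) ^ 3 - (n : ℂ)) / 12 * rank else 0) • (1 : Module.End ℂ V)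
  /-- `D = L(-1)` -/
  D_eq : D = VertexOperator.ncoeff (Y ω) 0
  /-- `V` is the direct sum over the integers `n` of the spaces `V_n` on which `L(0) = n Id` -/
  grading : DirectSum.IsInternal
    (fun n : ℤ => Module.End.eigenspace (VertexOperator.ncoeff (Y ω) 1) (n : ℂ))

/-- A module structure on `M` over the vertex operator algebra `A`: fields
`Y_M(a, z) = ∑ a_(n) z ^ (-n - 1)` on `M`, linear in `a`, with `Y_M(1, z) = Id_M` and satisfying the
Borcherds (Jacobi) identity. No grading of `M` is required. The infinitesimal translation of `M` is
the operator `ω_(0)` on `M`; that `[ω_(0), Y_M(a, z)] = Y_M(D a, z) = d/dz Y_M(a, z)` follows from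
the two conditions. -/
structure VOAModule {V : Type*} [AddCommGroup V] [Module ℂ V] (A : VertexOperatorAlgebra V)
    (M : Type*) [AddCommGroup M] [Module ℂ M] where
  /-- the action of `V` by fields on `M` -/
  Y : V →ₗ[ℂ] VertexOperator ℂ M
  /-- `Y_M(1, z) = Id_M` -/
  vacuum : ∀ n : ℤ, VertexOperator.ncoeff (Y A.vac) n = if n = -1 then 1 else 0
  /-- the Borcherds identity; all the sums have only finitely many nonzero terms -/
  borcherds : ∀ (a b : V) (x : M) (k m n : ℤ),
    ∑ᶠ j : ℕ, Ring.choose m j •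
        VertexOperator.ncoeff (Y (VertexOperator.ncoeff (A.Y a) (k + j) b)) (m + n - j) x
      = ∑ᶠ j : ℕ, (((k + j + 1).negOnePow : ℤ) * Ring.choose k j) •
          VertexOperator.ncoeff (Y b) (n + k - j) (VertexOperator.ncoeff (Y a) (m + j) x)
        + ∑ᶠ j : ℕ, ((-1 : ℤ) ^ j * Ring.choose k j) •
          VertexOperator.ncoeff (Y a) (m + k - j) (VertexOperator.ncoeff (Y b) (n + j) x)

/-- The module is faithful: `Y_M(a, z) = 0` only for `a = 0`. -/
def VOAModule.Faithful {V : Type*} [AddCommGroup V] [Module ℂ V] {A : VertexOperatorAlgebra V}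
    {M : Type*} [AddCommGroup M] [Module ℂ M] (X : VOAModule A M) : Prop :=
  ∀ a : V, X.Y a = 0 → a = 0

/-- The shifted field `∑_{s ∈ S} z ^ (-s) Y(a s, z)`, as a formal distribution. -/
noncomputable def shiftedField {V M : Type*} [AddCommGroup V] [Module ℂ V] [AddCommGroup M]
    [Module ℂ M] (Y : V →ₗ[ℂ] VertexOperator ℂ M) (S : Finset ℤ) (a : ℤ → V) :
    ℤ → Module.End ℂ M :=
  ∑ s ∈ S, FormalDist.shift (-s) (HVertexOperator.coeff (Y (a s)))

/-- The commutator identity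
`[∑_{s ∈ S} z ^ (-s) Y(a s, z), ∑_{k ∈ K} w ^ (-k) Y(b k, w)]
  = ∑_{n ∈ N} (∑_{j ∈ J n} w ^ (-j) Y(c n j, w)) * (z⁻¹ (∂/∂w)ⁿ δ(w / z))`. -/
def ShiftedCommutatorIdentity {V M : Type*} [AddCommGroup V] [Module ℂ V] [AddCommGroup M]
    [Module ℂ M] (Y : V →ₗ[ℂ] VertexOperator ℂ M) (S K : Finset ℤ) (N : Finset ℕ)
    (J : ℕ → Finset ℤ) (a b : ℤ → V) (c : ℕ → ℤ → V) : Prop :=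
  FormalDist.bracket (shiftedField Y S a) (shiftedField Y K b)
    = ∑ n ∈ N, FormalDist.mulW (shiftedField Y (J n) (c n))
        (FormalDist.derivW^[n] FormalDist.zInvDelta)

/-!
Let `W` be a space on which a linear map `Y` represents `V` by fields satisfying the commutator
formula `[Y(a, z), Y(b, w)] = ∑_j Y(a_(j) b, w) ∂_w ^ j (z⁻¹ δ(w / z)) / j!`. Comparing coefficients
of `z ^ p`, the commutator identity on `W` says that for every `p` a certain sum
`∑_t w ^ (-t) Y(v_t, w)` vanishes, where the finitely many `v_t ∈ V` are built from
`a`, `b`, `c` and the products of `V` and do not depend on `W` (`commutatorDefect`,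
`shiftedCommutatorIdentity_iff`).

If some operator `T` on `W` satisfies `[T, Y(a, z)] = d/dz Y(a, z)` and `Y` is injective, such a sum
vanishes only if all `v_t` are zero (`laurentField_injective`): bracketing with `T` and
differentiating show that `∑_t t w ^ (-t) Y(v_t, w)` vanishes too, so that all exponents but one can be
eliminated successively. This gives the first assertion, with `T = L(-1)`. It applies to `V` itself,
where `Y` is injective by the creation axiom, and to faithful modules, so on any of these the
commutator identity says that all `v_t` are zero, and this implies the identity on every module.

On a module the commutator formula is a case of the Borcherds identity. On `V` it is derived from
locality (`VertexAlgebra.commutatorFormula`): a distribution killed by `(z - w) ^ N` is a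
combination of derivatives of the delta distribution
(`FormalDist.eq_sum_of_mulSub_iterate_eq_zero`); its coefficients are local with respect to all
`Y(v, u)` by Dong's lemma (`FormalDist.Local.residueProduct`), and they are identified by Goddard's
uniqueness theorem (`VertexAlgebra.eq_zero_of_local`).
-/

open HVertexOperator

/-! ### Formal distributions and multiplication by `z - w` -/

namespace FormalDist

section Distributions

variable {E E' : Type*} [AddCommGroup E] [AddCommGroup E']

/-- Multiplication by `z - w` commutes with applying an additive map to the coefficients. -/
theorem map_mulSub_iterate (φ : E →+ E') (F : ℤ → ℤ → E) (n : ℕ) (p q : ℤ) :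
    mulSub^[n] (fun p q => φ (F p q)) p q = φ (mulSub^[n] F p q) := by
  induction n generalizing p q with
  | zero => rfl
  | succ n ih => simp only [Function.iterate_succ_apply', mulSub, ih, map_sub]

theorem mulSub_iterate_sub (F G : ℤ → ℤ → E) (n : ℕ) :
    mulSub^[n] (F - G) = mulSub^[n] F - mulSub^[n] G := by
  induction n with
  | zero => rfl
  | succ n ih =>
    simp only [Function.iterate_succ_apply', ih]
    funext p q
    simp only [mulSub, Pi.sub_apply]
    abel

theorem mulSub_iterate_zero (n : ℕ) : mulSub^[n] (0 : ℤ → ℤ → E) = 0 := by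
  simpa using mulSub_iterate_sub (0 : ℤ → ℤ → E) 0 n

theorem mulSub_iterate_eq_zero_of_le {F : ℤ → ℤ → E} {m n : ℕ} (h : mulSub^[m] F = 0)
    (hmn : m ≤ n) : mulSub^[n] F = 0 := by
  obtain ⟨k, rfl⟩ := Nat.exists_eq_add_of_le' hmn
  rw [Function.iterate_add_apply, h, mulSub_iterate_zero]

/-- A distribution annihilated by `(z - w) ^ N` is
`∑_{j < N} (Res_z (z - w) ^ j F(z, w)) * ∂_w ^ j (z⁻¹ δ(w / z)) / j!`. -/
theorem eq_sum_of_mulSub_iterate_eq_zero (N : ℕ) (F : ℤ → ℤ → E) (h : mulSub^[N] F = 0)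
    (p q : ℤ) :
    F p q = ∑ j ∈ Finset.range N,
      Ring.choose (-p - 1) j • mulSub^[j] F (-1) (p + q + 1 + j) := by
  induction N generalizing F p q with
  | zero =>
    have : F = 0 := h
    simp [this]
  | succ N ih =>
    have hG := ih (mulSub F) h
    -- the claim for `p - 1` is equivalent to the claim for `p`, by Pascal's rule
    have step : ∀ p q : ℤ,
        (F (p - 1) q - ∑ j ∈ Finset.range (N + 1),
          Ring.choose (-(p - 1) - 1) j • mulSub^[j] F (-1) ((p - 1) + q + 1 + j))
        = F p (q - 1) - ∑ j ∈ Finset.range (N + 1),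
          Ring.choose (-p - 1) j • mulSub^[j] F (-1) (p + (q - 1) + 1 + j) := by
      intro p q
      have h1 := hG p q
      simp only [mulSub] at h1
      rw [sub_eq_iff_eq_add] at h1
      rw [h1, Finset.sum_range_succ', Finset.sum_range_succ']
      have h2 : ∀ j ∈ Finset.range N,
          Ring.choose (-(p - 1) - 1) (j + 1) •
            mulSub^[j + 1] F (-1) ((p - 1) + q + 1 + (j + 1 : ℕ))
          = Ring.choose (-p - 1) j • mulSub^[j] (mulSub F) (-1) (p + q + 1 + j)
          + Ring.choose (-p - 1) (j + 1) •
            mulSub^[j + 1] F (-1) (p + (q - 1) + 1 + (j + 1 : ℕ)) := by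
        intro j _
        have e1 : -(p - 1) - 1 = (-p - 1) + 1 := by ring
        have e2 : (p - 1) + q + 1 + ((j + 1 : ℕ) : ℤ) = p + q + 1 + j := by push_cast; ring
        have e3 : p + (q - 1) + 1 + ((j + 1 : ℕ) : ℤ) = p + q + 1 + j := by push_cast; ring
        rw [e1, e2, e3, Ring.choose_succ_succ, add_smul, Function.iterate_succ_apply]
      rw [Finset.sum_congr rfl h2, Finset.sum_add_distrib]
      have e4 : (p - 1) + q + 1 + ((0 : ℕ) : ℤ) = p + (q - 1) + 1 + ((0 : ℕ) : ℤ) := by ring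
      rw [e4]
      simp only [Ring.choose_zero_right]
      abel
    rw [← sub_eq_zero]
    induction p using Int.inductionOn' (b := -1) generalizing q with
    | zero =>
      rw [Finset.sum_range_succ']
      simp [Ring.choose_zero_succ]
    | succ k _ ihk =>
      have := step (k + 1) (q + 1)
      rw [add_sub_cancel_right, add_sub_cancel_right] at this
      rw [← this]
      exact ihk (q + 1)
    | pred k _ ihk =>
      rw [step]
      exact ihk (q - 1)

theorem mulSub_iterate_eq_zero_of_neg {F : ℤ → ℤ → E} {c : ℤ}
    (h : ∀ p q, p < c → q < 0 → F p q = 0) (n : ℕ) {p q : ℤ} (hp : p < c) (hq : q < 0) :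
    mulSub^[n] F p q = 0 := by
  induction n generalizing p q with
  | zero => exact h p q hp hq
  | succ n ih =>
    rw [Function.iterate_succ_apply', mulSub, ih (by lia) hq, ih hp (by lia), sub_zero]

/-- If the powers of `w` in `F` are nonnegative, then setting `w = 0` turns `(z - w) ^ n` into
`z ^ n`. -/
theorem mulSub_iterate_apply_zero {F : ℤ → ℤ → E} {c : ℤ}
    (h : ∀ p q, p < c → q < 0 → F p q = 0) (n : ℕ) {p : ℤ} (hp : p < c) :
    mulSub^[n] F p 0 = F (p - n) 0 := by
  induction n generalizing p with
  | zero => simp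
  | succ n ih =>
    rw [Function.iterate_succ_apply', mulSub, ih (by lia),
      mulSub_iterate_eq_zero_of_neg h n hp (by lia), sub_zero]
    congr 1
    push_cast
    ring

/-- The operator `∂/∂z + ∂/∂w` commutes with multiplication by `z - w`. -/
theorem mulSub_iterate_derivation (δ : E →+ E) {F : ℤ → ℤ → E}
    (h : ∀ p q, δ (F p q) = (p + 1) • F (p + 1) q + (q + 1) • F p (q + 1)) (n : ℕ) (p q : ℤ) :
    δ (mulSub^[n] F p q)
      = (p + 1) • mulSub^[n] F (p + 1) q + (q + 1) • mulSub^[n] F p (q + 1) := by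
  induction n generalizing p q with
  | zero => exact h p q
  | succ n ih =>
    simp only [Function.iterate_succ_apply', mulSub, map_sub, ih, sub_add_cancel,
      add_sub_cancel_right]
    simp only [smul_sub, add_smul, one_smul]
    abel

/-- For commuting endomorphisms `f` and `g`, this is the binomial expansion of `(g - f) ^ (m + n)`
in the argument for Dong's lemma, done by induction. -/
theorem pow_sub_apply_eq_zero {G : Type*} [AddCommGroup G] {f g : Module.End ℤ G}
    (hfg : Commute f g) {m n l : ℕ} {x : G} (hm : (f ^ m) x = 0)
    (hn : ((g - f) ^ l) ((g ^ n) x) = 0) : ((g - f) ^ (l + m + n)) x = 0 := by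
  induction m generalizing n x with
  | zero =>
    have : x = 0 := hm
    simp [this]
  | succ m ihm =>
    induction n generalizing x with
    | zero =>
      have h0 : ((g - f) ^ l) x = 0 := hn
      rw [show l + (m + 1) + 0 = (m + 1) + l by ring, pow_add, Module.End.mul_apply, h0,
        map_zero]
    | succ n ihn =>
      have hf : Commute f (g - f) := hfg.sub_right (Commute.refl f)
      have hg : Commute g (g - f) := (Commute.refl g).sub_right hfg.symm
      have comm : ∀ {u v : Module.End ℤ G}, Commute u v → ∀ y, u (v y) = v (u y) :=
        fun huv y => DFunLike.congr_fun huv.eq y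
      have h1 : ((g - f) ^ (l + (m + 1) + n)) (g x) = 0 := by
        apply ihn
        · rw [comm (hfg.pow_left _), hm, map_zero]
        · rwa [← Module.End.mul_apply (g ^ n) g, ← pow_succ]
      have h2 : ((g - f) ^ (l + m + (n + 1))) (f x) = 0 := by
        apply ihm
        · rwa [← Module.End.mul_apply (f ^ m) f, ← pow_succ]
        · rw [← comm (hfg.pow_right _), ← comm (hf.pow_right _), hn, map_zero]
      rw [show l + (m + 1) + (n + 1) = (l + (m + 1) + n) + 1 by ring, pow_succ,
        Module.End.mul_apply, LinearMap.sub_apply, map_sub, h1,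
        show l + (m + 1) + n = l + m + (n + 1) by ring, h2, sub_zero]

/-! ### Distributions in three variables -/

/-- Multiplication by `z - w` on distributions in `z, w, u`. -/
def mulZW (E : Type*) [AddCommGroup E] : Module.End ℤ (ℤ → ℤ → ℤ → E) where
  toFun T := fun p q u => T (p - 1) q u - T p (q - 1) u
  map_smul' c T := by funext p q u; simp [smul_sub]
  map_add' S T := by funext p q u; simp only [Pi.add_apply]; abel

/-- Multiplication by `z - u` on distributions in `z, w, u`. -/
def mulZU (E : Type*) [AddCommGroup E] : Module.End ℤ (ℤ → ℤ → ℤ → E) where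
  toFun T := fun p q u => T (p - 1) q u - T p q (u - 1)
  map_smul' c T := by funext p q u; simp [smul_sub]
  map_add' S T := by funext p q u; simp only [Pi.add_apply]; abel

theorem commute_mulZW_mulZU : Commute (mulZW E) (mulZU E) := by
  refine LinearMap.ext fun T => ?_
  funext p q u
  simp only [Module.End.mul_apply, mulZW, mulZU, LinearMap.coe_mk, AddHom.coe_mk]
  abel

theorem mulZW_pow_apply (n : ℕ) (T : ℤ → ℤ → ℤ → E) (p q u : ℤ) :
    (mulZW E ^ n) T p q u = mulSub^[n] (fun p q => T p q u) p q := by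
  induction n generalizing p q with
  | zero => rfl
  | succ n ih =>
    rw [pow_succ', Module.End.mul_apply, Function.iterate_succ_apply']
    simp only [mulZW, LinearMap.coe_mk, AddHom.coe_mk, mulSub] at ih ⊢
    rw [ih, ih]

theorem mulZU_pow_apply (n : ℕ) (T : ℤ → ℤ → ℤ → E) (p q u : ℤ) :
    (mulZU E ^ n) T p q u = mulSub^[n] (fun p u => T p q u) p u := by
  induction n generalizing p u with
  | zero => rfl
  | succ n ih =>
    rw [pow_succ', Module.End.mul_apply, Function.iterate_succ_apply']
    simp only [mulZU, LinearMap.coe_mk, AddHom.coe_mk, mulSub] at ih ⊢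
    rw [ih, ih]

theorem mulWU_pow_apply (n : ℕ) (T : ℤ → ℤ → ℤ → E) (p q u : ℤ) :
    ((mulZU E - mulZW E) ^ n) T p q u = mulSub^[n] (T p) q u := by
  induction n generalizing q u with
  | zero => rfl
  | succ n ih =>
    rw [pow_succ', Module.End.mul_apply, Function.iterate_succ_apply']
    have : ∀ S : ℤ → ℤ → ℤ → E, (mulZU E - mulZW E) S p q u = S p (q - 1) u - S p q (u - 1) := by
      intro S
      rw [LinearMap.sub_apply]
      simp only [mulZU, mulZW, LinearMap.coe_mk, AddHom.coe_mk, Pi.sub_apply]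
      abel
    rw [this, ih, ih, mulSub]

end Distributions

/-! ### Locality and Dong's lemma -/

section Locality

variable {R : Type*} [Ring R]

/-- Two distributions with coefficients in a ring are mutually local if `(z - w) ^ n` annihilates
their commutator for some `n`. -/
def Local (f g : ℤ → R) : Prop := ∃ n : ℕ, mulSub^[n] (bracket f g) = 0

theorem Local.sub {f g h : ℤ → R} (hf : Local f h) (hg : Local g h) : Local (f - g) h := by
  obtain ⟨m, hm⟩ := hf
  obtain ⟨n, hn⟩ := hg
  refine ⟨max m n, ?_⟩
  have : bracket (f - g) h = bracket f h - bracket g h := by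
    funext p q
    simp only [bracket, Pi.sub_apply]
    noncomm_ring
  rw [this, mulSub_iterate_sub, mulSub_iterate_eq_zero_of_le hm (le_max_left _ _),
    mulSub_iterate_eq_zero_of_le hn (le_max_right _ _), sub_zero]

/-- The distribution `Res_z (z - w) ^ j [f(z), g(w)]`, the `j`-th product of `f` and `g`. -/
def residueProduct (f g : ℤ → R) (j : ℕ) : ℤ → R := mulSub^[j] (bracket f g) (-1)

/-- Dong's lemma for the nonnegative products: if `f`, `g`, `h` are mutually local, then so are
the products of `f` and `g`, and `h`. -/
theorem Local.residueProduct {f g h : ℤ → R} (hfg : Local f g) (hfh : Local f h)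
    (hgh : Local g h) (j : ℕ) : Local (residueProduct f g j) h := by
  obtain ⟨a, ha⟩ := hfg
  obtain ⟨b, hb⟩ := hfh
  obtain ⟨c, hc⟩ := hgh
  -- the commutator with a fixed element is additive
  let adR : R → R →+ R := fun y => AddMonoidHom.mulRight y - AddMonoidHom.mulLeft y
  let adL : R → R →+ R := fun x => AddMonoidHom.mulLeft x - AddMonoidHom.mulRight x
  have hR : ∀ x y, adR y x = x * y - y * x := fun _ _ => rfl
  have hL : ∀ x y, adL x y = x * y - y * x := fun _ _ => rfl
  let T : ℤ → ℤ → ℤ → R := fun p q u => adR (h u) (bracket f g p q)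
  let T₁ : ℤ → ℤ → ℤ → R := fun p q u => adL (f p) (bracket g h q u)
  let T₂ : ℤ → ℤ → ℤ → R := fun p q u => adL (g q) (bracket f h p u)
  have jacobi : T = T₁ - T₂ := by
    funext p q u
    simp only [T, T₁, T₂, hR, hL, bracket, Pi.sub_apply]
    noncomm_ring
  have comm : ∀ {u v : Module.End ℤ (ℤ → ℤ → ℤ → R)}, Commute u v → ∀ y, u (v y) = v (u y) :=
    fun huv y => DFunLike.congr_fun huv.eq y
  have hZW : (mulZW R ^ a) T = 0 := by
    funext p q u
    rw [mulZW_pow_apply, map_mulSub_iterate (adR (h u)), ha]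
    exact map_zero _
  have hT₁ : ((mulZU R - mulZW R) ^ c) T₁ = 0 := by
    funext p q u
    rw [mulWU_pow_apply, map_mulSub_iterate (adL (f p)), hc]
    exact map_zero _
  have hT₂ : (mulZU R ^ b) T₂ = 0 := by
    funext p q u
    rw [mulZU_pow_apply, map_mulSub_iterate (adL (g q)), hb]
    exact map_zero _
  have hcomm : Commute (mulZU R) (mulZU R - mulZW R) :=
    (Commute.refl _).sub_right commute_mulZW_mulZU.symm
  have hT : ((mulZU R - mulZW R) ^ c) ((mulZU R ^ b) T) = 0 := by
    rw [jacobi, map_sub, hT₂, sub_zero, ← comm (hcomm.pow_pow b c), hT₁, map_zero]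
  have key := pow_sub_apply_eq_zero commute_mulZW_mulZU hZW hT
  refine ⟨c + a + b, ?_⟩
  have hj : ((mulZU R - mulZW R) ^ (c + a + b)) ((mulZW R ^ j) T) = 0 := by
    have : Commute (mulZW R) (mulZU R - mulZW R) :=
      commute_mulZW_mulZU.sub_right (Commute.refl _)
    rw [← comm (this.pow_pow j _), key, map_zero]
  have hslice : bracket (FormalDist.residueProduct f g j) h = (mulZW R ^ j) T (-1) := by
    funext q u
    rw [mulZW_pow_apply, map_mulSub_iterate (adR (h u))]
    rfl
  funext q u
  rw [hslice, ← mulWU_pow_apply, hj]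
  rfl

end Locality

end FormalDist

/-! ### The commutator formula in a vertex algebra -/

theorem VertexOperator.exists_ncoeff_eq_zero {W : Type*} [AddCommGroup W] [Module ℂ W]
    (B : VertexOperator ℂ W) (x : W) : ∃ N : ℕ, ∀ j : ℕ, N ≤ j → VertexOperator.ncoeff B j x = 0 := by
  refine ⟨(-(HahnSeries.order ((HahnModule.of ℂ).symm (B x)))).toNat, fun j hj => ?_⟩
  exact VertexOperator.ncoeff_eq_zero_of_lt_order B j x (by lia)

section CommutatorFormula

variable {V : Type*} [AddCommGroup V] [Module ℂ V] {M : Type*} [AddCommGroup M] [Module ℂ M]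

/-- The commutator formula `[Y(a, z), Y(b, w)] = ∑_j Y(a_(j) b, w) ∂_w ^ j (z⁻¹ δ(w / z)) / j!` for a
state-field correspondence `Y` on `M`, where `a_(j) b` is computed in the vertex algebra `A`. The
sum may be cut off at any `N` with `a_(j) b = 0` for all `j ≥ N`. -/
def CommutatorFormula (A : VertexAlgebra V) (Y : V →ₗ[ℂ] VertexOperator ℂ M) : Prop :=
  ∀ (a b : V) (N : ℕ), (∀ j : ℕ, N ≤ j → VertexOperator.ncoeff (A.Y a) j b = 0) → ∀ p q : ℤ,
    FormalDist.bracket (coeff (Y a)) (coeff (Y b)) p q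
      = ∑ j ∈ Finset.range N, Ring.choose (-p - 1) j •
          coeff (Y (VertexOperator.ncoeff (A.Y a) j b)) (p + q + 1 + j)

end CommutatorFormula

namespace VertexAlgebra

open FormalDist

variable {V : Type*} [AddCommGroup V] [Module ℂ V] (A : VertexAlgebra V)

theorem D_mul_coeff_sub (a : V) (p : ℤ) :
    A.D * coeff (A.Y a) p - coeff (A.Y a) p * A.D = (p + 1) • coeff (A.Y a) (p + 1) := by
  rw [A.translation_bracket, A.translation_deriv, FormalDist.deriv]

theorem coeff_vac_of_neg (a : V) {p : ℤ} (hp : p < 0) : coeff (A.Y a) p A.vac = 0 := by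
  rw [VertexOperator.coeff_eq_ncoeff]
  exact A.creation_regular a _ (by lia)

theorem coeff_zero_vac (a : V) : coeff (A.Y a) 0 A.vac = a := by
  rw [VertexOperator.coeff_eq_ncoeff]
  exact A.creation_value a

theorem D_apply (a : V) : A.D a = VertexOperator.ncoeff (A.Y a) (-2) A.vac := by
  rw [← A.coeff_zero_vac (A.D a), A.translation_deriv, VertexOperator.ncoeff_apply]
  simp [FormalDist.deriv]

theorem D_vac : A.D A.vac = 0 := by
  rw [D_apply, A.vacuum]
  simp

theorem Y_injective (a : V) (h : A.Y a = 0) : a = 0 := by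
  rw [← A.coeff_zero_vac a, h, map_zero]
  rfl

/-- Goddard's uniqueness theorem: a distribution which is local with respect to all the fields
`Y(v, u)` and annihilates the vacuum is zero. -/
theorem eq_zero_of_local {d : ℤ → Module.End ℂ V} (hd : ∀ v, Local d (coeff (A.Y v)))
    (hvac : ∀ q, d q A.vac = 0) : d = 0 := by
  funext q
  refine LinearMap.ext fun v => ?_
  obtain ⟨n, hn⟩ := hd v
  let ev : Module.End ℂ V →+ V := (LinearMap.applyₗ A.vac).toAddMonoidHom
  have hev : ∀ f, ev f = f A.vac := fun _ => rfl
  let H : ℤ → ℤ → V := fun p u => ev (bracket d (coeff (A.Y v)) p u)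
  have hH : ∀ p u, H p u = d p (coeff (A.Y v) u A.vac) := by
    intro p u
    simp only [H, hev, bracket, LinearMap.sub_apply, Module.End.mul_apply, hvac, map_zero, sub_zero]
  -- multiplying by `(w - u) ^ n` and setting `u = 0` gives `w ^ n * d(w) v`
  have h0 : mulSub^[n] H (q + n) 0 = 0 := by
    rw [map_mulSub_iterate ev, hn]
    exact map_zero _
  rw [mulSub_iterate_apply_zero (c := q + n + 1) _ n (by lia), hH, A.coeff_zero_vac,
    add_sub_cancel_right] at h0
  · exact h0
  · intro p u _ hu
    rw [hH, A.coeff_vac_of_neg v hu, map_zero]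

theorem residueProduct_apply_vac_of_neg (a b : V) (j : ℕ) {q : ℤ} (hq : q < 0) :
    residueProduct (coeff (A.Y a)) (coeff (A.Y b)) j q A.vac = 0 := by
  let ev : Module.End ℂ V →+ V := (LinearMap.applyₗ A.vac).toAddMonoidHom
  have h := map_mulSub_iterate ev (bracket (coeff (A.Y a)) (coeff (A.Y b))) j (-1) q
  refine h.symm.trans (mulSub_iterate_eq_zero_of_neg (c := 0) ?_ j (by lia) hq)
  intro p q hp hq
  change (bracket (coeff (A.Y a)) (coeff (A.Y b)) p q) A.vac = 0
  simp only [bracket, LinearMap.sub_apply, Module.End.mul_apply, A.coeff_vac_of_neg _ hp,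
    A.coeff_vac_of_neg _ hq, map_zero, sub_zero]

theorem residueProduct_zero_apply_vac (a b : V) (j : ℕ) :
    residueProduct (coeff (A.Y a)) (coeff (A.Y b)) j 0 A.vac
      = VertexOperator.ncoeff (A.Y a) j b := by
  let ev : Module.End ℂ V →+ V := (LinearMap.applyₗ A.vac).toAddMonoidHom
  have h := map_mulSub_iterate ev (bracket (coeff (A.Y a)) (coeff (A.Y b))) j (-1) 0
  refine h.symm.trans ?_
  rw [mulSub_iterate_apply_zero (c := 0) _ j (by lia)]
  · change (bracket (coeff (A.Y a)) (coeff (A.Y b)) (-1 - j) 0) A.vac = _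
    simp only [bracket, LinearMap.sub_apply, Module.End.mul_apply, A.coeff_zero_vac,
      A.coeff_vac_of_neg a (show (-1 - (j : ℤ)) < 0 by lia), map_zero, sub_zero]
    rw [VertexOperator.ncoeff_apply, show (-1 - (j : ℤ)) = -j - 1 by ring]
  · intro p q hp hq
    change (bracket (coeff (A.Y a)) (coeff (A.Y b)) p q) A.vac = 0
    simp only [bracket, LinearMap.sub_apply, Module.End.mul_apply, A.coeff_vac_of_neg _ hp,
      A.coeff_vac_of_neg _ hq, map_zero, sub_zero]

/-- The residue products are translation covariant. -/
theorem D_mul_residueProduct_sub (a b : V) (j : ℕ) (q : ℤ) :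
    A.D * residueProduct (coeff (A.Y a)) (coeff (A.Y b)) j q
        - residueProduct (coeff (A.Y a)) (coeff (A.Y b)) j q * A.D
      = (q + 1) • residueProduct (coeff (A.Y a)) (coeff (A.Y b)) j (q + 1) := by
  let δ : Module.End ℂ V →+ Module.End ℂ V :=
    AddMonoidHom.mulLeft A.D - AddMonoidHom.mulRight A.D
  have hδ : ∀ f, δ f = A.D * f - f * A.D := fun _ => rfl
  have h := mulSub_iterate_derivation δ (F := bracket (coeff (A.Y a)) (coeff (A.Y b))) ?_ j (-1) q
  · rw [hδ] at h
    simpa [residueProduct] using h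
  · intro p q
    have e : δ (bracket (coeff (A.Y a)) (coeff (A.Y b)) p q)
        = bracket (fun p => A.D * coeff (A.Y a) p - coeff (A.Y a) p * A.D) (coeff (A.Y b)) p q
        + bracket (coeff (A.Y a))
          (fun p => A.D * coeff (A.Y b) p - coeff (A.Y b) p * A.D) p q := by
      simp only [hδ, bracket]
      noncomm_ring
    rw [e]
    simp only [bracket, A.D_mul_coeff_sub, smul_mul_assoc, mul_smul_comm, smul_sub]

/-- A translation covariant distribution which creates from the vacuum a power series is determined
on the vacuum by its constant term. -/
theorem apply_vac_eq_of_zero {f g : ℤ → Module.End ℂ V}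
    (hf : ∀ q, A.D * f q - f q * A.D = (q + 1) • f (q + 1))
    (hg : ∀ q, A.D * g q - g q * A.D = (q + 1) • g (q + 1))
    (hfn : ∀ q < 0, f q A.vac = 0) (hgn : ∀ q < 0, g q A.vac = 0)
    (h0 : f 0 A.vac = g 0 A.vac) (q : ℤ) : f q A.vac = g q A.vac := by
  rcases lt_or_ge q 0 with hq | hq
  · rw [hfn q hq, hgn q hq]
  · induction q, hq using Int.leInduction with
    | base => exact h0
    | succ q hq ih =>
      have key : (q + 1) • f (q + 1) A.vac = (q + 1) • g (q + 1) A.vac := by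
        rw [← LinearMap.smul_apply, ← LinearMap.smul_apply, ← hf, ← hg]
        simp only [LinearMap.sub_apply, Module.End.mul_apply, D_vac, map_zero, ih]
      have : Module.IsTorsionFree ℤ V := Module.IsTorsionFree.trans ℂ
      exact smul_right_injective V (by lia : q + 1 ≠ 0) key

/-- The `j`-th product of `Y(a, z)` and `Y(b, z)` is `Y(a_(j) b, z)`: by Dong's lemma the difference
is local with respect to all the fields `Y(v, z)`, and it annihilates the vacuum. -/
theorem residueProduct_eq (a b : V) (j : ℕ) :
    residueProduct (coeff (A.Y a)) (coeff (A.Y b)) j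
      = coeff (A.Y (VertexOperator.ncoeff (A.Y a) j b)) := by
  rw [← sub_eq_zero]
  refine A.eq_zero_of_local (fun v => ?_) fun q => ?_
  · exact ((show Local _ _ from A.locality a b).residueProduct (A.locality a v)
      (A.locality b v) j).sub (A.locality _ v)
  · rw [Pi.sub_apply, LinearMap.sub_apply, sub_eq_zero]
    refine A.apply_vac_eq_of_zero (A.D_mul_residueProduct_sub a b j) (A.D_mul_coeff_sub _)
      (fun q hq => A.residueProduct_apply_vac_of_neg a b j hq)
      (fun q hq => A.coeff_vac_of_neg _ hq) ?_ q
    rw [residueProduct_zero_apply_vac, coeff_zero_vac]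

theorem commutatorFormula : CommutatorFormula A A.Y := by
  intro a b N hN p q
  obtain ⟨L, hL⟩ := A.locality a b
  rw [eq_sum_of_mulSub_iterate_eq_zero (max N L) _
    (mulSub_iterate_eq_zero_of_le hL (le_max_right N L)) p q]
  symm
  have hsub : Finset.range N ⊆ Finset.range (max N L) :=
    Finset.range_subset_range.2 (le_max_left N L)
  have hprod : ∀ j : ℕ, mulSub^[j] (bracket (coeff (A.Y a)) (coeff (A.Y b))) (-1)
      = coeff (A.Y (VertexOperator.ncoeff (A.Y a) j b)) := A.residueProduct_eq a b
  simp only [hprod]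
  refine Finset.sum_subset hsub fun j _ hj => ?_
  rw [hN j (by simpa using hj), map_zero, map_zero]
  simp

end VertexAlgebra

/-! ### The commutator formula and the translation on a module -/

theorem Ring.choose_neg_two (j : ℕ) : Ring.choose (-2 : ℤ) j = (-1) ^ j * (j + 1) := by
  rw [Ring.choose_neg]
  have : (2 : ℤ) + j - 1 = ((j + 1 : ℕ) : ℤ) := by push_cast; ring
  rw [this, Ring.choose_natCast, Nat.choose_succ_self_right]
  simp [Int.negOnePow_def, Units.smul_def, mul_add]

namespace VOAModule

variable {V : Type*} [AddCommGroup V] [Module ℂ V] {A : VertexOperatorAlgebra V}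
    {M : Type*} [AddCommGroup M] [Module ℂ M] (X : VOAModule A M)

/-- The commutator formula on a module is the case `k = 0` of the Borcherds identity. -/
theorem commutatorFormula : CommutatorFormula A.toVertexAlgebra X.Y := by
  intro a b N hN p q
  refine LinearMap.ext fun x => ?_
  have h := X.borcherds a b x 0 (-p - 1) (-q - 1)
  rw [finsum_eq_single (fun j : ℕ => (((0 + j + 1 : ℤ).negOnePow : ℤ) * Ring.choose (0 : ℤ) j) • _) 0,
    finsum_eq_single (fun j : ℕ => ((-1 : ℤ) ^ j * Ring.choose (0 : ℤ) j) • _) 0,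
    finsum_eq_finsetSum_of_support_subset (s := Finset.range N)] at h
  · simp only [Ring.choose_zero_right, Nat.cast_zero, add_zero, sub_zero, zero_add, Int.negOnePow_one,
      Units.val_neg, Units.val_one, mul_one, pow_zero, one_smul, neg_smul] at h
    rw [FormalDist.bracket, LinearMap.sub_apply, Module.End.mul_apply, Module.End.mul_apply,
      VertexOperator.coeff_eq_ncoeff, VertexOperator.coeff_eq_ncoeff, sub_eq_neg_add]
    simp only [neg_sub_left, neg_add_rev] at h ⊢
    rw [← h, LinearMap.sum_apply]
    refine Finset.sum_congr rfl fun j _ => ?_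
    rw [LinearMap.smul_apply, VertexOperator.coeff_eq_ncoeff]
    rw [show -p + -1 + (-q + -1) - (j : ℤ) = -(p + q + 1 + j) - 1 by ring]
  · intro j hj
    by_contra hjN
    refine hj ?_
    change Ring.choose (-p - 1) j • _ = (0 : M)
    rw [zero_add, hN j (by simpa using hjN), map_zero, map_zero]
    simp
  · intro j hj
    rw [Ring.choose_zero_pos ℤ (Nat.pos_of_ne_zero hj), mul_zero, zero_smul]
  · intro j hj
    rw [Ring.choose_zero_pos ℤ (Nat.pos_of_ne_zero hj), mul_zero, zero_smul]

/-- The relation `Y(D a, z) = d/dz Y(a, z)` on a module: since `D a = a_(-2) 1`, it is the case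
`b = 1`, `k = -2`, `m = 0` of the Borcherds identity. -/
theorem ncoeff_D (a : V) (n : ℤ) :
    VertexOperator.ncoeff (X.Y (A.D a)) n = -n • VertexOperator.ncoeff (X.Y a) (n - 1) := by
  refine LinearMap.ext fun x => ?_
  have h := X.borcherds a A.vac x (-2) 0 n
  rw [finsum_eq_single (fun j : ℕ => Ring.choose (0 : ℤ) j • _) 0] at h
  · simp only [Ring.choose_zero_right, Nat.cast_zero, add_zero, sub_zero, zero_add, one_smul,
      ← A.D_apply, X.vacuum, Ring.choose_neg_two] at h
    rw [h, LinearMap.smul_apply]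
    rcases lt_or_ge 0 n with hn | hn
    · obtain ⟨i, rfl⟩ : ∃ i : ℕ, n = i + 1 := ⟨(n - 1).toNat, by lia⟩
      rw [finsum_eq_single _ i, finsum_eq_zero_of_forall_eq_zero]
      · rw [if_pos (by ring)]
        have e : ((-2 + (i : ℤ) + 1).negOnePow : ℤ) * ((-1) ^ i * (i + 1)) = -(i + 1) := by
          rw [show (-2 + (i : ℤ) + 1) = i - 1 by ring, Int.negOnePow_sub, Int.negOnePow_one]
          simp only [mul_neg, mul_one, Units.val_neg, Int.coe_negOnePow_natCast, neg_mul, ← mul_assoc]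
          rw [← pow_add, (Even.add_self i).neg_one_pow, one_mul]
        rw [e, add_zero, add_sub_cancel_right, Module.End.one_apply]
      · intro j
        rw [if_neg (by lia)]
        simp
      · intro j hj
        rw [if_neg (by lia)]
        simp
    · obtain ⟨i, rfl⟩ : ∃ i : ℕ, n = -i := ⟨(-n).toNat, by lia⟩
      rw [finsum_eq_zero_of_forall_eq_zero]
      · rcases i with _ | i
        · rw [finsum_eq_zero_of_forall_eq_zero]
          · simp
          · intro j
            rw [if_neg (by lia)]
            simp
        · rw [finsum_eq_single _ i]
          · rw [if_pos (by push_cast; ring)]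
            rw [← mul_assoc, ← pow_add, (Even.add_self i).neg_one_pow, one_mul, zero_add, neg_neg,
              Module.End.one_apply, show -((i + 1 : ℕ) : ℤ) - 1 = -2 - i by push_cast; ring,
              Nat.cast_succ]
          · intro j hj
            rw [if_neg (by lia)]
            simp
      · intro j
        rw [if_neg (by lia)]
        simp
  · intro j hj
    rw [Ring.choose_zero_pos ℤ (Nat.pos_of_ne_zero hj), zero_smul]

end VOAModule

theorem VOAModule.L_neg_one_mul_coeff_sub {V : Type*} [AddCommGroup V] [Module ℂ V]
    {A : VertexOperatorAlgebra V} {M : Type*} [AddCommGroup M] [Module ℂ M] (X : VOAModule A M)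
    (a : V) (p : ℤ) :
    VertexOperator.ncoeff (X.Y A.ω) 0 * coeff (X.Y a) p
        - coeff (X.Y a) p * VertexOperator.ncoeff (X.Y A.ω) 0
      = (p + 1) • coeff (X.Y a) (p + 1) := by
  obtain ⟨N, hN⟩ := VertexOperator.exists_ncoeff_eq_zero (A.Y A.ω) a
  have h := X.commutatorFormula A.ω a (N + 1) (fun j hj => hN j (by lia)) (-1) p
  rw [Finset.sum_range_succ', Finset.sum_eq_zero fun j _ => by
    rw [neg_neg, sub_self, Ring.choose_zero_succ, zero_smul]] at h
  rw [FormalDist.bracket, Nat.cast_zero, Ring.choose_zero_right, one_smul, zero_add, ← A.D_eq,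
    show -1 + p + 1 + 0 = p by ring, VertexOperator.coeff_eq_ncoeff (X.Y (A.D a)), X.ncoeff_D,
    VertexOperator.coeff_eq_ncoeff (X.Y A.ω)] at h
  rw [VertexOperator.coeff_eq_ncoeff (X.Y a) (p + 1)]
  rwa [show -(-1 : ℤ) - 1 = 0 by ring, show -(-p - 1) = p + 1 by ring,
    show -p - 1 - 1 = -(p + 1) - 1 by ring] at h

/-! ### Independence of the fields over the Laurent polynomials -/

section LaurentField

variable {V : Type*} [AddCommGroup V] [Module ℂ V] {M : Type*} [AddCommGroup M] [Module ℂ M]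

/-- The linear map sending the Laurent polynomial `∑_t z ^ (-t) v_t` with coefficients in `V`, encoded
as the finitely supported function `t ↦ v_t`, to the distribution `∑_t z ^ (-t) Y(v_t, z)`. -/
noncomputable def laurentField (Y : V →ₗ[ℂ] VertexOperator ℂ M) :
    (ℤ →₀ V) →ₗ[ℂ] (ℤ → Module.End ℂ M) :=
  Finsupp.lsum ℂ fun t => LinearMap.pi fun p => LinearMap.proj (p + t) ∘ₗ coeff ∘ₗ Y

variable (Y : V →ₗ[ℂ] VertexOperator ℂ M)

theorem laurentField_single (t : ℤ) (v : V) (p : ℤ) :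
    laurentField Y (Finsupp.single t v) p = coeff (Y v) (p + t) := by
  rw [laurentField, Finsupp.lsum_single]
  rfl

theorem shiftedField_apply (S : Finset ℤ) (a : ℤ → V) (p : ℤ) :
    shiftedField Y S a p = ∑ s ∈ S, coeff (Y (a s)) (p + s) := by
  simp only [shiftedField, Finset.sum_apply, FormalDist.shift, sub_neg_eq_add]

theorem shiftedField_eq_laurentField (S : Finset ℤ) (a : ℤ → V) :
    shiftedField Y S a = laurentField Y (∑ s ∈ S, Finsupp.single s (a s)) := by
  funext p
  simp only [shiftedField_apply, map_sum, Finset.sum_apply, laurentField_single]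

/-- The operator multiplying the coefficient `v_t` by `t - c`, that is, `-z d/dz - c`. -/
noncomputable def eulerSub (c : ℤ) : (ℤ →₀ V) →ₗ[ℂ] (ℤ →₀ V) :=
  Finsupp.lsum ℂ fun t => Finsupp.lsingle t ∘ₗ ((t - c) • LinearMap.id)

theorem eulerSub_single (c t : ℤ) (v : V) :
    eulerSub c (Finsupp.single t v) = Finsupp.single t ((t - c) • v) := by
  rw [eulerSub, Finsupp.lsum_single]
  rfl

theorem eulerSub_apply (c : ℤ) (x : ℤ →₀ V) (t : ℤ) : eulerSub c x t = (t - c) • x t := by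
  induction x using Finsupp.induction_linear with
  | zero => simp
  | add f g hf hg => rw [map_add, Finsupp.add_apply, hf, hg, Finsupp.add_apply, smul_add]
  | single s v =>
    rw [eulerSub_single]
    by_cases h : s = t
    · subst h; simp
    · simp [h]

/-- If an operator `T` acts on the fields as `d/dz`, then comparing `[T, -]` with `d/dz` shows that
`eulerSub c` preserves the kernel of `laurentField Y`. -/
theorem laurentField_eulerSub {T : Module.End ℂ M}
    (hT : ∀ a p, T * coeff (Y a) p - coeff (Y a) p * T = (p + 1) • coeff (Y a) (p + 1))
    (c : ℤ) {x : ℤ →₀ V} (hx : laurentField Y x = 0) : laurentField Y (eulerSub c x) = 0 := by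
  have key : ∀ (x : ℤ →₀ V) (p : ℤ), laurentField Y (eulerSub c x) (p + 1)
      = T * laurentField Y x p - laurentField Y x p * T
        - (p + 1 + c) • laurentField Y x (p + 1) := by
    intro x p
    induction x using Finsupp.induction_linear with
    | zero => simp
    | add f g hf hg =>
      simp only [map_add, Pi.add_apply, hf, hg, mul_add, add_mul, smul_add]
      abel
    | single t v =>
      rw [eulerSub_single]
      simp only [laurentField_single, hT, map_zsmul, Pi.smul_apply]
      rw [show p + 1 + t = p + t + 1 by ring, ← sub_smul]
      congr 1
      ring
  funext p
  have := key x (p - 1)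
  rw [sub_add_cancel, hx] at this
  simpa using this

/-- If `Y` is injective and some operator acts on the fields as `d/dz`, then the fields `Y(v, z)` are
linearly independent over the Laurent polynomials in `z`, in the sense that
`∑_t z ^ (-t) Y(v_t, z) = 0` only if all `v_t` are zero. -/
theorem laurentField_injective {T : Module.End ℂ M}
    (hT : ∀ a p, T * coeff (Y a) p - coeff (Y a) p * T = (p + 1) • coeff (Y a) (p + 1))
    (hY : ∀ a, Y a = 0 → a = 0) (x : ℤ →₀ V) (hx : laurentField Y x = 0) : x = 0 := by
  induction hn : x.support.card using Nat.strong_induction_on generalizing x with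
  | _ n ih =>
    by_contra hne
    obtain ⟨c, hc⟩ := Finsupp.support_nonempty_iff.2 hne
    -- `eulerSub c` removes the exponent `c` from the support, so that `x` is a single term
    have hsub : (eulerSub c x).support ⊆ x.support.erase c := by
      intro t ht
      rw [Finsupp.mem_support_iff, eulerSub_apply] at ht
      refine Finset.mem_erase.2 ⟨fun h => ht ?_, Finsupp.mem_support_iff.2 fun h => ht ?_⟩
      · rw [h, sub_self, zero_smul]
      · rw [h, smul_zero]
    have hz : eulerSub c x = 0 :=
      ih _ (hn ▸ (Finset.card_le_card hsub).trans_lt (Finset.card_erase_lt_of_mem hc)) _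
        (laurentField_eulerSub Y hT c hx) rfl
    have : Module.IsTorsionFree ℤ V := Module.IsTorsionFree.trans ℂ
    have hsingle : x = Finsupp.single c (x c) := by
      ext t
      by_cases h : c = t
      · subst h; simp
      · rw [Finsupp.single_eq_of_ne (Ne.symm h)]
        have := DFunLike.congr_fun hz t
        rw [eulerSub_apply, Finsupp.zero_apply] at this
        exact (smul_eq_zero.1 this).resolve_left (by lia)
    refine Finsupp.mem_support_iff.1 hc (hY _ (coeff_inj ?_))
    funext p
    have := congrFun hx (p - c)
    rw [hsingle, laurentField_single, sub_add_cancel] at this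
    rw [this, map_zero]
    rfl

end LaurentField

/-! ### The commutator identity in coefficients -/

namespace FormalDist

theorem derivW_iterate_zInvDelta_eq_zero (n : ℕ) {p q : ℤ} (h : q ≠ -p - 1 - n) :
    derivW^[n] zInvDelta p q = 0 := by
  induction n generalizing q with
  | zero => exact if_neg (by push_cast at h; lia)
  | succ n ih =>
    rw [Function.iterate_succ_apply', derivW, deriv, ih (by push_cast at h; lia), smul_zero]

theorem mulW_derivW_iterate_zInvDelta {E : Type*} [AddCommGroup E] [Module ℂ E] (g : ℤ → E) (n : ℕ)
    (p q : ℤ) : mulW g (derivW^[n] zInvDelta) p q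
      = derivW^[n] zInvDelta p (-p - 1 - n) • g (p + q + 1 + n) := by
  rw [mulW, finsum_eq_single _ (-p - 1 - n)]
  · rw [show q - (-p - 1 - n) = p + q + 1 + n by ring]
  · intro i hi
    rw [derivW_iterate_zInvDelta_eq_zero n hi, zero_smul]

end FormalDist

section Defect

variable {V : Type*} [AddCommGroup V] [Module ℂ V] {M : Type*} [AddCommGroup M] [Module ℂ M]

/-- The Laurent polynomial with coefficients in `V` which describes, by the commutator formula, the
coefficient of `z ^ p` in the difference of the two sides of the commutator identity, on every
module. The number `L` is a cutoff for the commutator formula. -/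
noncomputable def commutatorDefect (A : VertexAlgebra V) (L : ℕ) (S K : Finset ℤ) (N : Finset ℕ)
    (J : ℕ → Finset ℤ) (a b : ℤ → V) (c : ℕ → ℤ → V) (p : ℤ) : ℤ →₀ V :=
  (∑ s ∈ S, ∑ k ∈ K, ∑ j ∈ Finset.range L, Ring.choose (-(p + s) - 1) j •
      Finsupp.single (s + k + j) (VertexOperator.ncoeff (A.Y (a s)) j (b k)))
    - ∑ n ∈ N, FormalDist.derivW^[n] FormalDist.zInvDelta p (-p - 1 - n) •
      ∑ j ∈ J n, Finsupp.single (n + j) (c n j)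

theorem shiftedCommutatorIdentity_iff {A : VertexAlgebra V} {Y : V →ₗ[ℂ] VertexOperator ℂ M}
    (hY : CommutatorFormula A Y) {L : ℕ} {S K : Finset ℤ} (N : Finset ℕ) (J : ℕ → Finset ℤ)
    {a b : ℤ → V} (c : ℕ → ℤ → V)
    (hL : ∀ s ∈ S, ∀ k ∈ K, ∀ j : ℕ, L ≤ j → VertexOperator.ncoeff (A.Y (a s)) j (b k) = 0) :
    ShiftedCommutatorIdentity Y S K N J a b c
      ↔ ∀ p, laurentField Y (commutatorDefect A L S K N J a b c p) = 0 := by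
  have key : ∀ p q, laurentField Y (commutatorDefect A L S K N J a b c p) (p + q + 1)
      = FormalDist.bracket (shiftedField Y S a) (shiftedField Y K b) p q
        - (∑ n ∈ N, FormalDist.mulW (shiftedField Y (J n) (c n))
            (FormalDist.derivW^[n] FormalDist.zInvDelta)) p q := by
    intro p q
    have h1 : FormalDist.bracket (shiftedField Y S a) (shiftedField Y K b) p q
        = ∑ s ∈ S, ∑ k ∈ K,
          FormalDist.bracket (coeff (Y (a s))) (coeff (Y (b k))) (p + s) (q + k) := by
      simp only [FormalDist.bracket, shiftedField_apply, Finset.sum_mul_sum,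
        Finset.sum_sub_distrib]
      rw [Finset.sum_comm (s := K)]
    rw [h1, commutatorDefect, map_sub, Pi.sub_apply]
    simp only [map_sum, Finset.sum_apply, map_smul, map_zsmul, Pi.smul_apply, laurentField_single,
      FormalDist.mulW_derivW_iterate_zInvDelta, shiftedField_apply]
    congr 1
    · refine Finset.sum_congr rfl fun s hs => Finset.sum_congr rfl fun k hk => ?_
      rw [hY _ _ L (hL s hs k hk)]
      refine Finset.sum_congr rfl fun j _ => ?_
      rw [show p + q + 1 + (s + k + j) = p + s + (q + k) + 1 + j by ring]
    · refine Finset.sum_congr rfl fun n _ => ?_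
      simp only [add_assoc]
  constructor
  · intro h p
    funext r
    have := key p (r - p - 1)
    rw [show p + (r - p - 1) + 1 = r by ring] at this
    rw [this, h]
    exact sub_self _
  · intro h
    funext p q
    rw [← sub_eq_zero, ← key, h, Pi.zero_apply]

end Defect

theorem lemma5p4 {V : Type*} [AddCommGroup V] [Module ℂ V] (A : VertexOperatorAlgebra V)
    {M : Type*} [AddCommGroup M] [Module ℂ M] (X : VOAModule A M) :
    (X.Faithful → ∀ (S : Finset ℤ) (a : ℤ → V),
      shiftedField X.Y S a = 0 → ∀ s ∈ S, a s = 0) ∧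
    (∀ (S K : Finset ℤ) (N : Finset ℕ) (J : ℕ → Finset ℤ) (a b : ℤ → V) (c : ℕ → ℤ → V),
      ShiftedCommutatorIdentity A.Y S K N J a b c →
        ShiftedCommutatorIdentity X.Y S K N J a b c) ∧
    (X.Faithful →
      ∀ (S K : Finset ℤ) (N : Finset ℕ) (J : ℕ → Finset ℤ) (a b : ℤ → V) (c : ℕ → ℤ → V),
        ShiftedCommutatorIdentity X.Y S K N J a b c →
          ShiftedCommutatorIdentity A.Y S K N J a b c) := by
  have cutoff : ∀ (S K : Finset ℤ) (a b : ℤ → V), ∃ L : ℕ, ∀ s ∈ S, ∀ k ∈ K, ∀ j : ℕ, L ≤ j →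
      VertexOperator.ncoeff (A.Y (a s)) j (b k) = 0 := by
    intro S K a b
    choose f hf using fun s k => VertexOperator.exists_ncoeff_eq_zero (A.Y (a s)) (b k)
    exact ⟨S.sup fun s => K.sup fun k => f s k, fun s hs k hk j hj => hf s k j
      (((Finset.le_sup (f := fun k => f s k) hk).trans
        (Finset.le_sup (f := fun s => K.sup fun k => f s k) hs)).trans hj)⟩
  refine ⟨fun hX S a h s hs => ?_, fun S K N J a b c h => ?_, fun hX S K N J a b c h => ?_⟩
  · rw [shiftedField_eq_laurentField] at h
    have h0 := laurentField_injective X.Y X.L_neg_one_mul_coeff_sub hX _ h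
    simpa [Finsupp.single_apply, hs] using DFunLike.congr_fun h0 s
  · obtain ⟨L, hL⟩ := cutoff S K a b
    rw [shiftedCommutatorIdentity_iff A.commutatorFormula N J c hL] at h
    rw [shiftedCommutatorIdentity_iff X.commutatorFormula N J c hL]
    intro p
    rw [laurentField_injective A.Y A.D_mul_coeff_sub A.Y_injective _ (h p), map_zero]
  · obtain ⟨L, hL⟩ := cutoff S K a b
    rw [shiftedCommutatorIdentity_iff X.commutatorFormula N J c hL] at h
    rw [shiftedCommutatorIdentity_iff A.commutatorFormula N J c hL]
    intro p
    rw [laurentField_injective X.Y X.L_neg_one_mul_coeff_sub hX _ (h p), map_zero]
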